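/- Let $G$ be a finite group and let $T$ be a $G$-Tambara functor: commutative rings $T(X)$ for all finite $G$-sets $X$, with restrictions (ring homomorphisms) $T(Y)\to T(X)$, transfers (additive maps) $T(X)\to T(Y)$ and norms (multiplicative maps) $T(X)\to T(Y)$ for all $G$-maps $f\colon X\to Y$, each functorial in $f$, such that restrictions turn finite disjoint unions into products, restrictions commute with transfers and with norms along pullback squares, and norms distribute over transfers along exponential diagrams. (Equivalently, $T$ is a product-preserving functor to sets on the category of isomorphism classes of bispans $X\leftarrow A\to B\to Y$ of finite $G$-sets whose induced semirings $T(X)$ are rings.) An ideal $I$ of $T$ is a family of ideals $I(G/H)\subseteq T(G/H)$, one for each subgroup $H\le G$, closed under the restrictions, transfers and norms between $T(G/K)$ and $T(G/H)$ for $K\le H\le G$ and under the conjugations $T(G/H)\to T(G/gHg^{-1})$ for $g\in G$. Ideals are ordered by levelwise inclusion, and $T$ is Noetherian if every ascending chain $I_1\subseteq I_2\subseteq\cdots$ of ideals stabilizes. The product $IJ$ is the smallest ideal that contains $I(G/H)J(G/H)$ for all $H\le G$. An ideal $P\ne T$ is prime if $IJ\subseteq P$ implies $I\subseteq P$ or $J\subseteq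 P$ for all ideals $I,J$ of $T$. The Nakaoka spectrum $\mathrm{Spec}(T)$ is the set of prime ideals of $T$ with the topology whose closed sets are the sets $V(I)=\{P\in \mathrm{Spec}(T) : I\subseteq P\}$ for $I$ an ideal of $T$. Then: (a) $\mathrm{Spec}(T)$ is quasi-compact (every open cover has a finite subcover) and sober (every irreducible closed subset is the closure of exactly one point). (b) If $T$ is Noetherian, then $\mathrm{Spec}(T)$ is a Noetherian topological space, i.e. its open subsets satisfy the ascending chain condition. (c) If $T$ is Noetherian, then a subset $Z\subseteq \mathrm{Spec}(T)$ is closed if and only if $Z$ is the closure of a finite subset of $\mathrm{Spec}(T)$. -/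

import Mathlib

universe u v

/-- A commutative square of maps of finite `G`-sets

`W --q--> Y`
`|p       |g`
`v        v`
`X --f--> Z`

that is a pullback square. -/
structure IsPullbackSquare {G : Type u} [Group G] {W X Y Z : Type u}
    [MulAction G W] [MulAction G X] [MulAction G Y] [MulAction G Z]
    (p : W →[G] X) (q : W →[G] Y) (f : X →[G] Z) (g : Y →[G] Z) : Prop where
  comm : ∀ w, f (p w) = g (q w)
  existsUnique : ∀ x y, f x = g y → ∃! w, p w = x ∧ q w = y

/-- An exponential diagram of finite `G`-sets

`X <--p-- A <--e-- W`
`|f                |f'`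
`v                 v`
`Y <-----π-------- P`

This says that `P` is the dependent product of `A` along `f` and that `e` is the evaluation map:
`W` is the pullback of `X` and `P` over `Y`, and for every `y : Y` and every section `s` of `p`
over the fibre of `f` at `y` there is exactly one point `z` of `P` over `y` such that `e`, restricted
to the fibre of `f'` at `z` (which is identified with the fibre of `f` at `y`), is `s`. -/
structure IsExponentialDiagram {G : Type u} [Group G] {A X Y W P : Type u}
    [MulAction G A] [MulAction G X] [MulAction G Y] [MulAction G W] [MulAction G P]
    (p : A →[G] X) (f : X →[G] Y) (e : W →[G] A) (f' : W →[G] P) (π : P →[G] Y) : Prop where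
  isPullback : IsPullbackSquare (p.comp e) f' f π
  existsUnique_section : ∀ (y : Y) (s : {x : X // f x = y} → A), (∀ x, p (s x) = x) →
    ∃! z : P, π z = y ∧ ∀ x, ∃ w, f' w = z ∧ e w = s x

/-- The left inclusion `X → X ⊔ Y` of finite `G`-sets. -/
def GSet.inl (G : Type u) [Group G] (X Y : Type u) [MulAction G X] [MulAction G Y] :
    X →[G] X ⊕ Y where
  toFun := Sum.inl
  map_smul' _ _ := rfl

/-- The right inclusion `Y → X ⊔ Y`. -/
def GSet.inr (G : Type u) [Group G] (X Y : Type u) [MulAction G X] [MulAction G Y] :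
    Y →[G] X ⊕ Y where
  toFun := Sum.inr
  map_smul' _ _ := rfl

/-- A `G`-Tambara functor, in terms of its restrictions `res f`, transfers `tr f` and norms `nm f`
along all maps `f` of finite `G`-sets. The value on the bispan
`X <--f-- A --g--> B --h--> Y` is `tr h ∘ nm g ∘ res f`; the interchange laws below are
the rules for the composition of bispans. The ring structure on `obj X` is determined by the rest:
addition and multiplication are transfer and norm along the fold map `X ⊔ X → X`, because transfers
are additive, norms are multiplicative, and the functor takes disjoint unions to products. -/
structure TambaraFunctor (G : Type u) [Group G] where
  obj (X : Type u) [Finite X] [MulAction G X] : Type v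
  [commRing (X : Type u) [Finite X] [MulAction G X] : CommRing (obj X)]
  res {X Y : Type u} [Finite X] [MulAction G X] [Finite Y] [MulAction G Y] (f : X →[G] Y) :
    obj Y →+* obj X
  tr {X Y : Type u} [Finite X] [MulAction G X] [Finite Y] [MulAction G Y] (f : X →[G] Y) :
    obj X →+ obj Y
  nm {X Y : Type u} [Finite X] [MulAction G X] [Finite Y] [MulAction G Y] (f : X →[G] Y) :
    obj X →* obj Y
  res_id (X : Type u) [Finite X] [MulAction G X] (a : obj X) : res (MulActionHom.id G) a = a
  tr_id (X : Type u) [Finite X] [MulAction G X] (a : obj X) : tr (MulActionHom.id G) a = a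
  nm_id (X : Type u) [Finite X] [MulAction G X] (a : obj X) : nm (MulActionHom.id G) a = a
  res_comp {X Y Z : Type u} [Finite X] [MulAction G X] [Finite Y] [MulAction G Y]
    [Finite Z] [MulAction G Z] (f : X →[G] Y) (g : Y →[G] Z) (a : obj Z) :
    res (g.comp f) a = res f (res g a)
  tr_comp {X Y Z : Type u} [Finite X] [MulAction G X] [Finite Y] [MulAction G Y]
    [Finite Z] [MulAction G Z] (f : X →[G] Y) (g : Y →[G] Z) (a : obj X) :
    tr (g.comp f) a = tr g (tr f a)
  nm_comp {X Y Z : Type u} [Finite X] [MulAction G X] [Finite Y] [MulAction G Y]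
    [Finite Z] [MulAction G Z] (f : X →[G] Y) (g : Y →[G] Z) (a : obj X) :
    nm (g.comp f) a = nm g (nm f a)
  /-- The empty disjoint union goes to the one-point set. -/
  subsingleton_of_isEmpty (X : Type u) [Finite X] [MulAction G X] [IsEmpty X] :
    Subsingleton (obj X)
  /-- Binary disjoint unions go to products. -/
  bijective_res_sum (X Y : Type u) [Finite X] [MulAction G X] [Finite Y] [MulAction G Y] :
    Function.Bijective fun a : obj (X ⊕ Y) => (res (GSet.inl G X Y) a, res (GSet.inr G X Y) a)
  /-- Restriction and transfer interchange along pullback squares. -/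
  res_tr {W X Y Z : Type u} [Finite W] [MulAction G W] [Finite X] [MulAction G X]
    [Finite Y] [MulAction G Y] [Finite Z] [MulAction G Z]
    (p : W →[G] X) (q : W →[G] Y) (f : X →[G] Z) (g : Y →[G] Z)
    (h : IsPullbackSquare p q f g) (a : obj X) : res g (tr f a) = tr q (res p a)
  /-- Restriction and norm interchange along pullback squares. -/
  res_nm {W X Y Z : Type u} [Finite W] [MulAction G W] [Finite X] [MulAction G X]
    [Finite Y] [MulAction G Y] [Finite Z] [MulAction G Z]
    (p : W →[G] X) (q : W →[G] Y) (f : X →[G] Z) (g : Y →[G] Z)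
    (h : IsPullbackSquare p q f g) (a : obj X) : res g (nm f a) = nm q (res p a)
  /-- The distributive law of norms over transfers. -/
  nm_tr {A X Y W P : Type u} [Finite A] [MulAction G A] [Finite X] [MulAction G X]
    [Finite Y] [MulAction G Y] [Finite W] [MulAction G W] [Finite P] [MulAction G P]
    (p : A →[G] X) (f : X →[G] Y) (e : W →[G] A) (f' : W →[G] P) (π : P →[G] Y)
    (h : IsExponentialDiagram p f e f' π) (a : obj A) : nm f (tr p a) = tr π (nm f' (res e a))

attribute [instance] TambaraFunctor.commRing

namespace TambaraFunctor

/-- The conjugate subgroup `g H g⁻¹`. -/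
def conjSubgroup {G : Type u} [Group G] (H : Subgroup G) (g : G) : Subgroup G :=
  H.map (MulAut.conj g).toMonoidHom

/-- The projection `G/K → G/H`, `aK ↦ aH`, for `K ≤ H`. -/
def quotMap {G : Type u} [Group G] {K H : Subgroup G} (h : K ≤ H) : (G ⧸ K) →[G] (G ⧸ H) where
  toFun := Subgroup.quotientMapOfLE h
  map_smul' g x := by
    induction x using Quotient.inductionOn'
    rfl

/-- The bijection `G/gHg⁻¹ → G/H`, `a gHg⁻¹ ↦ a g H`. -/
def conjMap {G : Type u} [Group G] (H : Subgroup G) (g : G) :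
    (G ⧸ conjSubgroup H g) →[G] (G ⧸ H) where
  toFun := Quotient.lift (fun a : G => ((a * g : G) : G ⧸ H)) (by
    intro a b hab
    have hab' : a⁻¹ * b ∈ conjSubgroup H g := QuotientGroup.leftRel_apply.1 hab
    obtain ⟨x, hx, hxab⟩ := hab'
    refine QuotientGroup.eq.2 ?_
    have hx' : g * x * g⁻¹ = a⁻¹ * b := by simpa using hxab
    have : (a * g)⁻¹ * (b * g) = x := by
      calc (a * g)⁻¹ * (b * g) = g⁻¹ * (a⁻¹ * b) * g := by group
        _ = x := by rw [← hx']; group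
    rw [this]
    exact hx)
  map_smul' c x := by
    induction x using Quotient.inductionOn' with
    | h a => exact congrArg (fun b : G => (b : G ⧸ H)) (mul_assoc c a g)

section

variable {G : Type u} [Group G] [Finite G] (T : TambaraFunctor.{u, v} G)

/-- The value `T(G/H)`. -/
abbrev level (H : Subgroup G) : Type v := T.obj (G ⧸ H)

/-- The restriction `T(G/H) → T(G/K)` for `K ≤ H`. -/
def resLE {K H : Subgroup G} (h : K ≤ H) : T.level H →+* T.level K := T.res (quotMap h)

/-- The transfer `T(G/K) → T(G/H)` for `K ≤ H`. -/
def trLE {K H : Subgroup G} (h : K ≤ H) : T.level K →+ T.level H := T.tr (quotMap h)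

/-- The norm `T(G/K) → T(G/H)` for `K ≤ H`. -/
def nmLE {K H : Subgroup G} (h : K ≤ H) : T.level K →* T.level H := T.nm (quotMap h)

/-- The conjugation `T(G/H) → T(G/gHg⁻¹)`. -/
def conj (H : Subgroup G) (g : G) : T.level H →+* T.level (conjSubgroup H g) :=
  T.res (conjMap H g)

/-- An ideal of a Tambara functor: a family of ideals of the rings `T(G/H)` that is closed under
restriction, transfer, norm and conjugation. -/
@[ext]
structure TIdeal where
  level (H : Subgroup G) : Ideal (T.level H)
  resLE_mem {K H : Subgroup G} (h : K ≤ H) {x : T.level H} : x ∈ level H → T.resLE h x ∈ level K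
  trLE_mem {K H : Subgroup G} (h : K ≤ H) {x : T.level K} : x ∈ level K → T.trLE h x ∈ level H
  nmLE_mem {K H : Subgroup G} (h : K ≤ H) {x : T.level K} : x ∈ level K → T.nmLE h x ∈ level H
  conj_mem (H : Subgroup G) (g : G) {x : T.level H} :
    x ∈ level H → T.conj H g x ∈ level (conjSubgroup H g)

namespace TIdeal

variable {T}

/-- Inclusion of ideals, level by level. -/
instance : PartialOrder (TIdeal T) :=
  PartialOrder.lift TIdeal.level fun _ _ h => TIdeal.ext h

theorem le_def {I J : TIdeal T} : I ≤ J ↔ ∀ H, I.level H ≤ J.level H := Iff.rfl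

/-- The improper ideal `T` of `T`. -/
instance : Top (TIdeal T) where
  top :=
    { level := fun _ => ⊤
      resLE_mem := fun _ _ _ => trivial
      trLE_mem := fun _ _ _ => trivial
      nmLE_mem := fun _ _ _ => trivial
      conj_mem := fun _ _ _ _ => trivial }

/-- The ideal generated by a levelwise collection of subsets:
the intersection of all ideals that contain it. -/
def span (S : ∀ H : Subgroup G, Set (T.level H)) : TIdeal T where
  level H := ⨅ J : {J : TIdeal T // ∀ K, S K ⊆ J.level K}, J.1.level H
  resLE_mem h _ hx := Ideal.mem_iInf.2 fun J => J.1.resLE_mem h (Ideal.mem_iInf.1 hx J)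
  trLE_mem h _ hx := Ideal.mem_iInf.2 fun J => J.1.trLE_mem h (Ideal.mem_iInf.1 hx J)
  nmLE_mem h _ hx := Ideal.mem_iInf.2 fun J => J.1.nmLE_mem h (Ideal.mem_iInf.1 hx J)
  conj_mem H g _ hx := Ideal.mem_iInf.2 fun J => J.1.conj_mem H g (Ideal.mem_iInf.1 hx J)

theorem span_le {S : ∀ H : Subgroup G, Set (T.level H)} {J : TIdeal T} :
    span S ≤ J ↔ ∀ H, S H ⊆ J.level H :=
  ⟨fun h H _ hx => h H (Ideal.mem_iInf.2 fun K => K.2 H hx),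
    fun h _ _ hx => Ideal.mem_iInf.1 hx ⟨J, h⟩⟩

/-- The product of two ideals: the ideal generated by the products `I(G/H) J(G/H)`. -/
instance : Mul (TIdeal T) where
  mul I J := span fun H => ((I.level H * J.level H : Ideal (T.level H)) : Set (T.level H))

theorem mul_le {I J K : TIdeal T} : I * J ≤ K ↔ ∀ H, I.level H * J.level H ≤ K.level H := span_le

/-- A prime ideal: a proper ideal `P` such that `IJ ⊆ P` implies `I ⊆ P` or `J ⊆ P`. -/
def IsPrime (P : TIdeal T) : Prop := P ≠ ⊤ ∧ ∀ I J : TIdeal T, I * J ≤ P → I ≤ P ∨ J ≤ P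

end TIdeal

/-- A Noetherian Tambara functor: every ascending chain of ideals stabilizes. -/
def IsNoetherian : Prop :=
  ∀ I : ℕ → TIdeal T, (∀ n, I n ≤ I (n + 1)) → ∃ N, ∀ n, N ≤ n → I n = I (n + 1)

/-- The set of prime ideals of a Tambara functor. -/
def Spec : Type (max u v) := {P : TIdeal T // P.IsPrime}

variable {T} in
/-- The set of prime ideals that contain `I`. -/
def V (I : TIdeal T) : Set (Spec T) := {P | I ≤ P.1}

theorem V_top : V (⊤ : TIdeal T) = ∅ :=
  Set.eq_empty_iff_forall_notMem.2 fun P hP => P.2.1 (TIdeal.ext (funext fun H =>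
    top_le_iff.1 (hP H)))

variable {T} in
theorem V_mul (I J : TIdeal T) : V (I * J) = V I ∪ V J :=
  Set.ext fun P => ⟨P.2.2 I J, fun h => TIdeal.mul_le.2 fun H =>
    h.elim (fun h => Ideal.mul_le_left.trans (h H)) fun h => Ideal.mul_le_right.trans (h H)⟩

theorem sInter_V (A : Set (Set (Spec T))) (hA : A ⊆ {Z | ∃ I : TIdeal T, Z = V I}) :
    ∃ I : TIdeal T, ⋂₀ A = V I := by
  refine ⟨TIdeal.span fun H => ⋃ I : {I : TIdeal T // V I ∈ A}, (I.1.level H : Set (T.level H)), ?_⟩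
  ext P
  constructor
  · intro h
    refine TIdeal.span_le.2 fun H => Set.iUnion_subset fun I => ?_
    exact (h _ I.2 : I.1 ≤ P.1) H
  · intro h Z hZ
    obtain ⟨I, rfl⟩ := hA hZ
    exact fun H x hx => TIdeal.span_le.1 h H (Set.mem_iUnion.2 ⟨⟨I, hZ⟩, hx⟩)

/-- The Nakaoka spectrum: the closed sets are the sets `V I`, for `I` an ideal of `T`. -/
instance : TopologicalSpace (Spec T) :=
  TopologicalSpace.ofClosed {Z | ∃ I : TIdeal T, Z = V I} ⟨⊤, (V_top T).symm⟩ (sInter_V T)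
    (by
      rintro _ ⟨I, rfl⟩ _ ⟨J, rfl⟩
      exact ⟨I * J, (V_mul I J).symm⟩)

end

end TambaraFunctor

/-- A sober space: every irreducible closed subset is the closure of exactly one point. -/
def IsSober (X : Type u) [TopologicalSpace X] : Prop :=
  ∀ Z : Set X, IsIrreducible Z → IsClosed Z → ∃! z : X, Z = closure {z}

/-! Quasi-compactness reduces to the ring `T(G/1)`. For an ideal `m` of `T(G/1)`, the elements all
of whose restrictions along maps `G/1 → G/H` lie in `m` form an ideal of `T` (`coinduced`). This is
right adjoint to `I ↦ I(G/1)` (`le_coinduced`), hence prime when `m` is. Conversely, an ideal with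
`1` at level `G/1` is improper, because norms preserve `1`. So closed sets `V(I_i)` have empty
intersection only if the ideals `I_i(G/1)` sum to the unit ideal, and finitely many of them already
suffice. Sobriety and (b) come from the dictionary between closed sets and their vanishing ideals:
irreducible sets have prime vanishing ideals, and these are the generic points. For (c), a
Noetherian space has finitely many irreducible components, each with a generic point. -/

/-! ### Pullback squares -/

namespace IsPullbackSquare

variable {G : Type u} [Group G] {X Y Z : Type u} [MulAction G X] [MulAction G Y] [MulAction G Z]

/-- The standard fibre product of two maps of `G`-sets. -/
def fiberProduct (f : X →[G] Z) (g : Y →[G] Z) : SubMulAction G (X × Y) where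
  carrier := {w | f w.1 = g w.2}
  smul_mem' c w hw := by
    change f (c • w.1) = g (c • w.2)
    rw [map_smul, map_smul, show f w.1 = g w.2 from hw]

/-- The first projection of the fibre product. -/
def fst (f : X →[G] Z) (g : Y →[G] Z) : fiberProduct f g →[G] X where
  toFun w := w.1.1
  map_smul' _ _ := rfl

/-- The second projection of the fibre product. -/
def snd (f : X →[G] Z) (g : Y →[G] Z) : fiberProduct f g →[G] Y where
  toFun w := w.1.2
  map_smul' _ _ := rfl

theorem of_fiberProduct (f : X →[G] Z) (g : Y →[G] Z) :
    IsPullbackSquare (fst f g) (snd f g) f g where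
  comm w := w.2
  existsUnique x y h :=
    ⟨⟨(x, y), h⟩, ⟨rfl, rfl⟩, fun _ hw => Subtype.ext (Prod.ext hw.1 hw.2)⟩

theorem isEmpty_fiberProduct (f : X →[G] Z) (g : Y →[G] Z) (h : ∀ x y, f x ≠ g y) :
    IsEmpty (fiberProduct f g) :=
  ⟨fun w => h _ _ w.2⟩

theorem of_injective (f : X →[G] Z) (hf : Function.Injective f) :
    IsPullbackSquare (MulActionHom.id G) (MulActionHom.id G) f f where
  comm _ := rfl
  existsUnique x _ h := ⟨x, ⟨rfl, hf h⟩, fun _ hw => hw.1⟩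

theorem of_rightInverse (f : X →[G] Z) (r : Z →[G] X) (hl : Function.LeftInverse r f)
    (hr : Function.RightInverse r f) :
    IsPullbackSquare r (MulActionHom.id G) f (MulActionHom.id G) where
  comm z := hr z
  existsUnique x z h := ⟨z, ⟨by rw [← show f x = z from h, hl], rfl⟩, fun _ hw => hw.2⟩

end IsPullbackSquare

/-! ### Orbits and complements of `G`-sets -/

namespace GSet

variable {G : Type u} [Group G]

/-- The map `G/1 → W` with `1 ↦ w`. -/
def orbitMap {W : Type u} [MulAction G W] (w : W) : (G ⧸ (⊥ : Subgroup G)) →[G] W where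
  toFun := Quotient.lift (fun a : G => a • w) (by
    intro a b hab
    have h : a⁻¹ * b ∈ (⊥ : Subgroup G) := QuotientGroup.leftRel_apply.1 hab
    rw [inv_mul_eq_one.1 (Subgroup.mem_bot.1 h)])
  map_smul' c x := by
    induction x using Quotient.inductionOn' with
    | h a => exact mul_smul c a w

/-- Two maps out of `G/H` agree if they agree on the coset of `1`. -/
theorem hom_ext {H : Subgroup G} {W : Type u} [MulAction G W] {f f' : (G ⧸ H) →[G] W}
    (h : f ((1 : G) : G ⧸ H) = f' ((1 : G) : G ⧸ H)) : f = f' := by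
  ext x
  induction x using Quotient.inductionOn' with
  | h a =>
    have ha : (Quotient.mk'' a : G ⧸ H) = a • ((1 : G) : G ⧸ H) :=
      congrArg (fun b : G => (b : G ⧸ H)) (mul_one a).symm
    rw [ha, map_smul, map_smul, h]

theorem bijective_end [Finite G] {H : Subgroup G} (f : (G ⧸ H) →[G] (G ⧸ H)) :
    Function.Bijective f := by
  have hs : Function.Surjective f := fun y => by
    obtain ⟨c, hc⟩ := MulAction.exists_smul_eq G (f ((1 : G) : G ⧸ H)) y
    exact ⟨c • ((1 : G) : G ⧸ H), by rw [map_smul, hc]⟩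
  exact ⟨Finite.injective_iff_surjective.2 hs, hs⟩

/-- The complement of the image of a map of `G`-sets. -/
def rangeCompl {X W : Type u} [MulAction G X] [MulAction G W] (i : X →[G] W) :
    SubMulAction G W where
  carrier := (Set.range i)ᶜ
  smul_mem' c w hw := by
    rintro ⟨x, hx⟩
    exact hw ⟨c⁻¹ • x, by rw [map_smul, hx, inv_smul_smul]⟩

theorem mem_range_or_rangeCompl {X W : Type u} [MulAction G X] [MulAction G W] (i : X →[G] W)
    (w : W) : (∃ x, i x = w) ∨ ∃ y, (rangeCompl i).subtype y = w := by
  by_cases h : ∃ x, i x = w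
  · exact Or.inl h
  · exact Or.inr ⟨⟨w, h⟩, rfl⟩

/-- The map out of a disjoint union given by its two restrictions. -/
def sumElim {X Y W : Type u} [MulAction G X] [MulAction G Y] [MulAction G W] (i : X →[G] W)
    (j : Y →[G] W) : X ⊕ Y →[G] W where
  toFun := Sum.elim i j
  map_smul' c x := by
    cases x
    · exact map_smul i c _
    · exact map_smul j c _

end GSet

namespace TambaraFunctor

open IsPullbackSquare

theorem quotMap_surjective {G : Type u} [Group G] {K H : Subgroup G} (h : K ≤ H) :
    Function.Surjective (quotMap h) := by
  intro y
  induction y using Quotient.inductionOn' with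
  | h a => exact ⟨(a : G ⧸ K), rfl⟩

/-! ### Transfers and norms along disjoint unions and isomorphisms -/

section Decomposition

variable {G : Type u} [Group G] (T : TambaraFunctor.{u, v} G)
variable {X Y W : Type u} [Finite X] [MulAction G X] [Finite Y] [MulAction G Y]
  [Finite W] [MulAction G W]

theorem res_tr_of_injective (f : X →[G] W) (hf : Function.Injective f) (a : T.obj X) :
    T.res f (T.tr f a) = a := by
  rw [T.res_tr _ _ _ _ (of_injective f hf), T.tr_id, T.res_id]

theorem res_nm_of_injective (f : X →[G] W) (hf : Function.Injective f) (a : T.obj X) :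
    T.res f (T.nm f a) = a := by
  rw [T.res_nm _ _ _ _ (of_injective f hf), T.nm_id, T.res_id]

/-- The pullback is empty and `T(∅)` is the zero ring. For norms the same argument yields `1`, since
a norm preserves `1` and a transfer preserves `0`. -/
theorem res_tr_of_disjoint (i : X →[G] W) (j : Y →[G] W) (h : ∀ x y, i x ≠ j y) (a : T.obj X) :
    T.res j (T.tr i a) = 0 := by
  have := isEmpty_fiberProduct i j h
  have := T.subsingleton_of_isEmpty (fiberProduct i j)
  rw [T.res_tr _ _ _ _ (of_fiberProduct i j), Subsingleton.elim (T.res _ a) 0, map_zero]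

theorem res_nm_of_disjoint (i : X →[G] W) (j : Y →[G] W) (h : ∀ x y, i x ≠ j y) (a : T.obj X) :
    T.res j (T.nm i a) = 1 := by
  have := isEmpty_fiberProduct i j h
  have := T.subsingleton_of_isEmpty (fiberProduct i j)
  rw [T.res_nm _ _ _ _ (of_fiberProduct i j), Subsingleton.elim (T.res _ a) 1, map_one]

theorem tr_eq_res (f : X →[G] Y) (r : Y →[G] X) (hl : Function.LeftInverse r f)
    (hr : Function.RightInverse r f) (a : T.obj X) : T.tr f a = T.res r a := by
  have := T.res_tr _ _ _ _ (of_rightInverse f r hl hr) a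
  rwa [T.res_id, T.tr_id] at this

theorem nm_eq_res (f : X →[G] Y) (r : Y →[G] X) (hl : Function.LeftInverse r f)
    (hr : Function.RightInverse r f) (a : T.obj X) : T.nm f a = T.res r a := by
  have := T.res_nm _ _ _ _ (of_rightInverse f r hl hr) a
  rwa [T.res_id, T.nm_id] at this

/-- An element over a disjoint union is determined by its restrictions to the two parts. -/
theorem eq_of_res_eq (i : X →[G] W) (j : Y →[G] W) (hi : Function.Injective i)
    (hj : Function.Injective j) (h : ∀ x y, i x ≠ j y) (hw : ∀ w, (∃ x, i x = w) ∨ ∃ y, j y = w)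
    {a b : T.obj W} (h₁ : T.res i a = T.res i b) (h₂ : T.res j a = T.res j b) : a = b := by
  have hbij : Function.Bijective (GSet.sumElim i j) := by
    refine ⟨Function.Injective.sumElim hi hj h, fun w => ?_⟩
    rcases hw w with ⟨x, hx⟩ | ⟨y, hy⟩
    · exact ⟨Sum.inl x, hx⟩
    · exact ⟨Sum.inr y, hy⟩
  obtain ⟨r, hl, hr⟩ := Function.bijective_iff_has_inverse.1 hbij
  let ρ : W →[G] X ⊕ Y := (GSet.sumElim i j).inverse r hl hr
  have hρ : (GSet.sumElim i j).comp ρ = MulActionHom.id G := by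
    ext w
    exact hr w
  have key : T.res (GSet.sumElim i j) a = T.res (GSet.sumElim i j) b := by
    apply (T.bijective_res_sum X Y).1
    refine Prod.ext ?_ ?_
    · change T.res _ (T.res _ a) = T.res _ (T.res _ b)
      rw [← T.res_comp, ← T.res_comp]
      exact h₁
    · change T.res _ (T.res _ a) = T.res _ (T.res _ b)
      rw [← T.res_comp, ← T.res_comp]
      exact h₂
  rw [← T.res_id W a, ← T.res_id W b, ← hρ, T.res_comp, T.res_comp, key]

theorem eq_tr_add_tr (i : X →[G] W) (j : Y →[G] W) (hi : Function.Injective i)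
    (hj : Function.Injective j) (h : ∀ x y, i x ≠ j y) (hw : ∀ w, (∃ x, i x = w) ∨ ∃ y, j y = w)
    (a : T.obj W) : a = T.tr i (T.res i a) + T.tr j (T.res j a) := by
  apply T.eq_of_res_eq i j hi hj h hw
  · rw [map_add, T.res_tr_of_injective i hi, T.res_tr_of_disjoint j i fun y x => (h x y).symm,
      add_zero]
  · rw [map_add, T.res_tr_of_injective j hj, T.res_tr_of_disjoint i j h, zero_add]

theorem eq_nm_mul_nm (i : X →[G] W) (j : Y →[G] W) (hi : Function.Injective i)
    (hj : Function.Injective j) (h : ∀ x y, i x ≠ j y) (hw : ∀ w, (∃ x, i x = w) ∨ ∃ y, j y = w)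
    (a : T.obj W) : a = T.nm i (T.res i a) * T.nm j (T.res j a) := by
  apply T.eq_of_res_eq i j hi hj h hw
  · rw [map_mul, T.res_nm_of_injective i hi, T.res_nm_of_disjoint j i fun y x => (h x y).symm,
      mul_one]
  · rw [map_mul, T.res_nm_of_injective j hj, T.res_nm_of_disjoint i j h, one_mul]

end Decomposition

/-! ### Ideals of `T` coinduced from `T(G/1)` -/

section Underlying

variable {G : Type u} [Group G] [Finite G] (T : TambaraFunctor.{u, v} G)

/-- A point of a `G`-set `W` over `G/1` splits off a copy of `G/1`. -/
theorem exists_splitting {W : Type u} [MulAction G W] (q : W →[G] (G ⧸ (⊥ : Subgroup G))) (w : W) :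
    ∃ (i : (G ⧸ (⊥ : Subgroup G)) →[G] W) (r : (G ⧸ (⊥ : Subgroup G)) →[G] (G ⧸ (⊥ : Subgroup G))),
      Function.Injective i ∧ Function.LeftInverse r (q.comp i) ∧
        Function.RightInverse r (q.comp i) ∧ i ((1 : G) : G ⧸ (⊥ : Subgroup G)) = w := by
  have hb := GSet.bijective_end (q.comp (GSet.orbitMap w))
  obtain ⟨r, hl, hr⟩ := Function.bijective_iff_has_inverse.1 hb
  exact ⟨GSet.orbitMap w, (q.comp (GSet.orbitMap w)).inverse r hl hr,
    Function.Injective.of_comp hb.1, hl, hr, one_smul G w⟩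

variable (m : Ideal (T.level ⊥))

/-- A `G`-set over `G/1` is free, so copies of `G/1` can be split off one at a time. On each copy
`q` is an isomorphism, and its transfer is restriction along the inverse. -/
theorem tr_mem_of_forall_res_mem (n : ℕ) {W : Type u} [Finite W] [MulAction G W]
    (hn : Nat.card W ≤ n) (q : W →[G] (G ⧸ (⊥ : Subgroup G))) (a : T.obj W)
    (ha : ∀ r : (G ⧸ (⊥ : Subgroup G)) →[G] W, T.res r a ∈ m) : T.tr q a ∈ m := by
  induction n generalizing W with
  | zero =>
    have : IsEmpty W := (Nat.card_eq_zero.1 (Nat.le_zero.1 hn)).resolve_right fun h =>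
      h.not_finite inferInstance
    have := T.subsingleton_of_isEmpty W
    rw [Subsingleton.elim a 0, map_zero]
    exact m.zero_mem
  | succ n ih =>
    rcases isEmpty_or_nonempty W with hW | ⟨⟨w⟩⟩
    · have := T.subsingleton_of_isEmpty W
      rw [Subsingleton.elim a 0, map_zero]
      exact m.zero_mem
    · obtain ⟨i, r, hi, hl, hr, hiw⟩ := exists_splitting q w
      rw [T.eq_tr_add_tr i (GSet.rangeCompl i).subtype hi (SubMulAction.subtype_injective _)
        (fun x y h => y.2 ⟨x, h⟩) (GSet.mem_range_or_rangeCompl i) a, map_add, ← T.tr_comp,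
        ← T.tr_comp]
      refine m.add_mem ?_ (ih ?_ _ _ fun r => ?_)
      · rw [T.tr_eq_res _ r hl hr, ← T.res_comp]
        exact ha _
      -- The complement is smaller because it misses `w`, which lies in the image of `i`.
      · have : Nat.card (GSet.rangeCompl i) < Nat.card W :=
          Finite.card_subtype_lt (x := w) (not_not_intro ⟨_, hiw⟩)
        omega
      · rw [← T.res_comp]
        exact ha _

/-- Norms multiply over disjoint parts, so a single orbit with value in `m` is enough. One orbit
must exist: the norm from the empty set is `1`. -/
theorem nm_mem_of_forall_res_mem {W : Type u} [Finite W] [MulAction G W] [Nonempty W]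
    (q : W →[G] (G ⧸ (⊥ : Subgroup G))) (a : T.obj W)
    (ha : ∀ r : (G ⧸ (⊥ : Subgroup G)) →[G] W, T.res r a ∈ m) : T.nm q a ∈ m := by
  obtain ⟨i, r, hi, hl, hr, -⟩ := exists_splitting q (Classical.arbitrary W)
  rw [T.eq_nm_mul_nm i (GSet.rangeCompl i).subtype hi (SubMulAction.subtype_injective _)
    (fun x y h => y.2 ⟨x, h⟩) (GSet.mem_range_or_rangeCompl i) a, map_mul, ← T.nm_comp]
  refine m.mul_mem_right _ ?_
  rw [T.nm_eq_res _ r hl hr, ← T.res_comp]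
  exact ha _

/-- The largest ideal of `T` whose value at `G/1` is contained in `m`. -/
def TIdeal.coinduced : TIdeal T where
  level H := ⨅ f : (G ⧸ (⊥ : Subgroup G)) →[G] (G ⧸ H), m.comap (T.res f)
  resLE_mem h x hx := Ideal.mem_iInf.2 fun f => by
    rw [Ideal.mem_comap, resLE, ← T.res_comp]
    exact Ideal.mem_iInf.1 hx _
  trLE_mem h x hx := Ideal.mem_iInf.2 fun f => by
    rw [Ideal.mem_comap, trLE, T.res_tr _ _ _ _ (of_fiberProduct (quotMap h) f)]
    refine T.tr_mem_of_forall_res_mem m _ le_rfl _ _ fun r => ?_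
    rw [← T.res_comp]
    exact Ideal.mem_iInf.1 hx _
  nmLE_mem h x hx := Ideal.mem_iInf.2 fun f => by
    rw [Ideal.mem_comap, nmLE, T.res_nm _ _ _ _ (of_fiberProduct (quotMap h) f)]
    -- Surjectivity of `G/K → G/H` excludes the empty norm.
    have : Nonempty (fiberProduct (quotMap h) f) := by
      obtain ⟨x, hx⟩ := quotMap_surjective h (f ((1 : G) : G ⧸ (⊥ : Subgroup G)))
      exact ⟨⟨(x, _), hx⟩⟩
    refine T.nm_mem_of_forall_res_mem m _ _ fun r => ?_
    rw [← T.res_comp]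
    exact Ideal.mem_iInf.1 hx _
  conj_mem H g x hx := Ideal.mem_iInf.2 fun f => by
    rw [Ideal.mem_comap, conj, ← T.res_comp]
    exact Ideal.mem_iInf.1 hx _

variable {T m}

namespace TIdeal

theorem mem_coinduced {H : Subgroup G} {x : T.level H} :
    x ∈ (coinduced T m).level H ↔
      ∀ f : (G ⧸ (⊥ : Subgroup G)) →[G] (G ⧸ H), T.res f x ∈ m :=
  Ideal.mem_iInf

/-- Every map `G/1 → G/H` is a projection followed by a conjugation. -/
theorem res_mem_level_bot (I : TIdeal T) {H : Subgroup G} {x : T.level H} (hx : x ∈ I.level H)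
    (f : (G ⧸ (⊥ : Subgroup G)) →[G] (G ⧸ H)) : T.res f x ∈ I.level ⊥ := by
  obtain ⟨g, hg⟩ := QuotientGroup.mk_surjective (f ((1 : G) : G ⧸ (⊥ : Subgroup G)))
  have hf : f = (conjMap H g).comp (quotMap bot_le) := by
    apply GSet.hom_ext
    rw [← hg]
    exact congrArg (fun b : G => (b : G ⧸ H)) (one_mul g).symm
  rw [hf, T.res_comp]
  exact I.resLE_mem bot_le (I.conj_mem H g hx)

theorem le_coinduced {I : TIdeal T} : I ≤ coinduced T m ↔ I.level ⊥ ≤ m :=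
  ⟨fun h x hx => by simpa [T.res_id] using mem_coinduced.1 (h ⊥ hx) (MulActionHom.id G),
    fun h _ _ hx => mem_coinduced.2 fun f => h (I.res_mem_level_bot hx f)⟩

/-- By the adjunction, both conditions move to level `G/1`, where `(IJ)(G/1)` contains
`I(G/1)J(G/1)`. -/
theorem isPrime_coinduced (hm : m.IsPrime) : (coinduced T m).IsPrime := by
  constructor
  · intro h
    exact hm.ne_top (top_le_iff.1 (le_coinduced.1 h.ge))
  · intro I J h
    have := le_coinduced.1 h
    rw [le_coinduced, le_coinduced]
    refine hm.mul_le.1 (le_trans ?_ this)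
    exact mul_le.1 le_rfl ⊥

theorem eq_top_of_one_mem {I : TIdeal T} (h : (1 : T.level ⊥) ∈ I.level ⊥) : I = ⊤ :=
  TIdeal.ext <| funext fun H => (Ideal.eq_top_iff_one _).2 <| by
    simpa using I.nmLE_mem (bot_le : ⊥ ≤ H) h

end TIdeal

end Underlying

/-! ### Closed sets and vanishing ideals -/

section Topology

variable {G : Type u} [Group G] [Finite G] {T : TambaraFunctor.{u, v} G}

theorem isClosed_iff_exists_V {Z : Set T.Spec} : IsClosed Z ↔ ∃ I : TIdeal T, Z = V I := by
  rw [← isOpen_compl_iff]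
  change Zᶜᶜ ∈ {Z | ∃ I : TIdeal T, Z = V I} ↔ _
  rw [compl_compl]
  rfl

/-- The intersection of the primes in a set. -/
def vanishingIdeal (Z : Set T.Spec) : TIdeal T where
  level H := ⨅ P : Z, P.1.1.level H
  resLE_mem h _ hx := Ideal.mem_iInf.2 fun P => P.1.1.resLE_mem h (Ideal.mem_iInf.1 hx P)
  trLE_mem h _ hx := Ideal.mem_iInf.2 fun P => P.1.1.trLE_mem h (Ideal.mem_iInf.1 hx P)
  nmLE_mem h _ hx := Ideal.mem_iInf.2 fun P => P.1.1.nmLE_mem h (Ideal.mem_iInf.1 hx P)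
  conj_mem H g _ hx := Ideal.mem_iInf.2 fun P => P.1.1.conj_mem H g (Ideal.mem_iInf.1 hx P)

theorem le_vanishingIdeal {I : TIdeal T} {Z : Set T.Spec} :
    I ≤ vanishingIdeal Z ↔ Z ⊆ V I :=
  ⟨fun h P hP H _ hx => Ideal.mem_iInf.1 (h H hx) ⟨P, hP⟩,
    fun h H _ hx => Ideal.mem_iInf.2 fun P => h P.2 H hx⟩

theorem V_anti {I J : TIdeal T} (h : I ≤ J) : V J ⊆ V I := fun _ hP => h.trans hP

theorem V_vanishingIdeal {Z : Set T.Spec} (hZ : IsClosed Z) : V (vanishingIdeal Z) = Z := by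
  obtain ⟨I, rfl⟩ := isClosed_iff_exists_V.1 hZ
  exact (V_anti (le_vanishingIdeal.2 subset_rfl)).antisymm (le_vanishingIdeal.1 le_rfl)

theorem closure_singleton (P : T.Spec) : closure {P} = V P.1 := by
  apply subset_antisymm
  · exact closure_minimal (Set.singleton_subset_iff.2 (le_refl P.1))
      (isClosed_iff_exists_V.2 ⟨_, rfl⟩)
  · obtain ⟨I, hI⟩ := isClosed_iff_exists_V.1 (isClosed_closure (s := {P}))
    rw [hI]
    refine V_anti ?_
    have : P ∈ closure {P} := subset_closure rfl
    rwa [hI] at this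

theorem isPrime_vanishingIdeal {Z : Set T.Spec} (hZ : IsIrreducible Z) :
    (vanishingIdeal Z).IsPrime := by
  constructor
  · intro h
    obtain ⟨P, hP⟩ := hZ.1
    have := le_vanishingIdeal.1 h.ge hP
    rw [V_top] at this
    exact this
  · intro I J h
    -- The inclusion becomes a covering of `Z` by the closed sets `V I` and `V J`.
    rw [le_vanishingIdeal, V_mul] at h
    rw [le_vanishingIdeal, le_vanishingIdeal]
    exact isPreirreducible_iff_isClosed_union_isClosed.1 hZ.2 _ _
      (isClosed_iff_exists_V.2 ⟨I, rfl⟩) (isClosed_iff_exists_V.2 ⟨J, rfl⟩) h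

theorem isSober_spec : IsSober T.Spec := by
  intro Z hZ hc
  refine ⟨⟨vanishingIdeal Z, isPrime_vanishingIdeal hZ⟩, ?_, ?_⟩
  · exact ((closure_singleton _).trans (V_vanishingIdeal hc)).symm
  · intro P hP
    rw [closure_singleton] at hP
    refine Subtype.ext (le_antisymm ?_ ?_)
    · exact le_vanishingIdeal.2 hP.le
    · have : P ∈ Z := hP ▸ (le_refl P.1 : P ∈ V P.1)
      exact le_vanishingIdeal.1 le_rfl this

instance compactSpace_spec : CompactSpace T.Spec := by
  refine compactSpace_of_finite_subfamily_closed fun {ι} Z hZ he => ?_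
  choose I hI using fun i => isClosed_iff_exists_V.1 (hZ i)
  have htop : ⨆ i, (I i).level ⊥ = ⊤ := by
    by_contra hne
    obtain ⟨m, hm, hle⟩ := Ideal.exists_le_maximal _ hne
    -- A maximal ideal above the sum would coinduce to a point common to all `Z i`.
    have : (⟨_, TIdeal.isPrime_coinduced hm.isPrime⟩ : T.Spec) ∈ ⋂ i, Z i := by
      refine Set.mem_iInter.2 fun i => ?_
      rw [hI]
      exact TIdeal.le_coinduced.2 ((le_iSup (fun i => (I i).level ⊥) i).trans hle)
    rw [he] at this
    exact this
  obtain ⟨s, hs⟩ := Submodule.mem_iSup_iff_exists_finset.1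
    ((Ideal.eq_top_iff_one _).1 htop)
  refine ⟨s, Set.eq_empty_iff_forall_notMem.2 fun P hP => P.2.1 ?_⟩
  have hle : ⨆ i ∈ s, (I i).level ⊥ ≤ P.1.level ⊥ := iSup₂_le fun i hi => ?_
  · exact TIdeal.eq_top_of_one_mem (hle hs)
  have := Set.mem_iInter₂.1 hP i hi
  rw [hI] at this
  exact this ⊥

theorem noetherianSpace_spec (hT : T.IsNoetherian) : TopologicalSpace.NoetherianSpace T.Spec := by
  refine ((wellFoundedGT_iff_monotone_chain_condition)).2 fun U => ?_
  obtain ⟨N, hN⟩ := hT (fun n => vanishingIdeal ((U n : Set T.Spec)ᶜ)) fun n =>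
    le_vanishingIdeal.2 (subset_trans (Set.compl_subset_compl.2 (U.monotone n.le_succ))
      (le_vanishingIdeal.1 le_rfl))
  refine ⟨N, fun n hn => ?_⟩
  induction n, hn using Nat.le_induction with
  | base => rfl
  | succ n hn ih =>
    rw [ih]
    apply TopologicalSpace.Opens.ext
    rw [← compl_inj_iff, ← V_vanishingIdeal (U n).isOpen.isClosed_compl,
      ← V_vanishingIdeal (U (n + 1)).isOpen.isClosed_compl]
    exact congrArg V (hN n hn)

end Topology

end TambaraFunctor

/-! ### Finite sets of generic points -/

/-- In a sober Noetherian space every closed set is the closure of a finite set. -/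
theorem IsSober.isClosed_iff_exists_finite {X : Type u} [TopologicalSpace X] (h : IsSober X)
    [TopologicalSpace.NoetherianSpace X] {Z : Set X} :
    IsClosed Z ↔ ∃ F : Set X, F.Finite ∧ Z = closure F := by
  constructor
  · intro hZ
    obtain ⟨S, hS, hc, hi, rfl⟩ :=
      TopologicalSpace.NoetherianSpace.exists_finite_set_isClosed_irreducible hZ
    have hg : ∀ t : S, ∃ z, t.1 = closure {z} := fun t => (h t.1 (hi t t.2) (hc t t.2)).exists
    choose z hz using hg
    have := hS.to_subtype
    refine ⟨Set.range z, Set.finite_range z, ?_⟩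
    rw [← Set.iUnion_singleton_eq_range, closure_iUnion_of_finite, Set.sUnion_eq_iUnion]
    exact Set.iUnion_congr hz
  · rintro ⟨F, -, rfl⟩
    exact isClosed_closure

theorem theoremA {G : Type u} [Group G] [Finite G] (T : TambaraFunctor.{u, v} G) :
    CompactSpace T.Spec ∧ IsSober T.Spec ∧
      (T.IsNoetherian → TopologicalSpace.NoetherianSpace T.Spec ∧
        ∀ Z : Set T.Spec, IsClosed Z ↔ ∃ F : Set T.Spec, F.Finite ∧ Z = closure F) := by
  refine ⟨TambaraFunctor.compactSpace_spec, TambaraFunctor.isSober_spec, fun hT => ?_⟩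
  have := TambaraFunctor.noetherianSpace_spec hT
  exact ⟨this, fun Z => TambaraFunctor.isSober_spec.isClosed_iff_exists_finite⟩
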